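/- **Setting.** Let $N\ge 1$, $L>n\ge 0$ be integers and $\omega=e^{2\pi i/N}$. On a ring of $L$ sites $j\in\mathbb Z/L$ consider the Hilbert space $\bigotimes_j\mathbb C^N$ with orthonormal basis $|s\rangle$, $s\in(\mathbb Z/N)^{\mathbb Z/L}$, and the operators $\mathcal Z_j|s\rangle=\omega^{s_j}|s\rangle$, $\mathcal X_j|s\rangle=|s+e_j\rangle$. Let $T$ be the translation with $T\mathcal X_jT^{-1}=\mathcal X_{j-1}$, i.e. $T|s\rangle=|s'\rangle$ with $s'_j=s_{j+1}$, so that $T\prod_j\mathcal X_j^{f_j}T^{-1}=\prod_j\mathcal X_j^{f_{j+1}}$. Let $\mathfrak H=\bigotimes_j\mathfrak H_j$ be the Hadamard operator, $\mathfrak H_j|b\rangle=N^{-1/2}\sum_a\omega^{-ab}|a\rangle$, and let $\mathsf C|s\rangle=|-s\rangle$. Let $\Delta=(\Delta_{j,\ell})$ be a $\mathbb Z/N$-valued matrix indexed by the sites such that $\Delta_{j+k,\ell+k}=\Delta_{j,\ell}$, $\Delta_{j,\ell}=0$ unless $\ell\in\{j,j+1,\dots,j+n\}$, and $\Delta_{j,j},\Delta_{j,j+n}$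 are invertible mod $N$. The generalized Ising Hamiltonian is, for real $J,h$, $$H=-\sum_j\Big\{J\prod_\ell\mathcal Z_\ell^{\Delta_{j,\ell}}+h\,\mathcal X_j+\mathrm{H.c.}\Big\}.$$ For $q=1,\dots,n$ let $f^{(q)}:\mathbb Z\to\mathbb Z/N$ be the solution of $\sum_{k=0}^n\Delta_{1,1+k}f_{j+k}=0$ for all $j\in\mathbb Z$ with $f^{(q)}_j=\delta_{j,q}$ for $1\le j\le n$. Assume that $f^{(q)}_{j+L}=f^{(q)}_j$ for all $q,j$, and put $U_q=\prod_j\mathcal X_j^{f^{(q)}_j}$. Assume that the model is reflection symmetric: for some $\sigma\in\{+1,-1\}$, $$\Delta^{\mathsf T}_{j,\ell}=\sigma\,\Delta_{j-n,\ell}\quad\text{for all }j,\ell.$$ Let $\tilde{\mathsf D}_{\rm KW}$ be the gauging map $|s\rangle\mapsto|-\Delta s\rangle$ followed by $\mathfrak H^{-1}=\mathfrak H^\dagger$, that is, $\tilde{\mathsf D}_{\rm KW}|s\rangle=N^{-L/2}\sum_m\omega^{-m\cdot\Delta s}|m\rangle$, and let $$\mathsf D_{\rm KW}=T^{-\lfloor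 (n+1)/2\rfloor}\,\tilde{\mathsf D}_{\rm KW}.$$ **Theorem.** 1. $\tilde{\mathsf D}_{\rm KW}$ implements the Kramers–Wannier transformation $$\tilde{\mathsf D}_{\rm KW}\prod_\ell\mathcal Z_\ell^{\Delta_{j,\ell}}=\mathcal X_j\,\tilde{\mathsf D}_{\rm KW},\qquad \tilde{\mathsf D}_{\rm KW}\,\mathcal X_j=\prod_\ell\mathcal Z_\ell^{-\Delta^{\mathsf T}_{j,\ell}}\,\tilde{\mathsf D}_{\rm KW}\qquad\text{for all }j,$$ and every operator satisfying these relations is a scalar multiple of it. 2. $\mathsf D_{\rm KW}$ commutes with $H$ whenever $J=h$. 3. $\mathsf D_{\rm KW}\mathsf D_{\rm KW}=\mathfrak H^{1+\sigma}\,(T^\dagger)^{(n\bmod 2)}\prod_{q=1}^n\sum_{a=0}^{N-1}U_q^a$. 4. $U_q\mathsf D_{\rm KW}=\mathsf D_{\rm KW}U_q=\mathsf D_{\rm KW}$ for all $q$. 5. $\mathsf D_{\rm KW}^\dagger=\mathsf D_{\rm KW}\,\mathfrak H^{1+\sigma}\,T^{(n\bmod 2)}$. 6. Thus the square involves a translation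 (by one site) only for odd $n$: it is $\mathfrak H^{1+\sigma}\prod_q\sum_aU_q^a$ for even $n$ and $\mathfrak H^{1+\sigma}T^\dagger\prod_q\sum_aU_q^a$ for odd $n$. It involves charge conjugation when $\sigma=+1$: $\mathfrak H^{1+\sigma}=\mathsf C$ if $\sigma=+1$ and $\mathfrak H^{1+\sigma}=1$ if $\sigma=-1$, where $\mathsf C\mathcal X_j=\mathcal X_j^\dagger\mathsf C$ and $\mathsf C\mathcal Z_j=\mathcal Z_j^\dagger\mathsf C$. 7. The operator $\mathsf D=T^{-\lfloor n/2\rfloor}\tilde{\mathsf D}_{\rm KW}$ also commutes with $H$ at $J=h$, satisfies $U_q\mathsf D=\mathsf D U_q=\mathsf D$ for all $q$, and obeys the algebra with the opposite direction of translation: $\mathsf D\mathsf D=\mathfrak H^{1+\sigma}T^{(n\bmod 2)}\prod_q\sum_aU_q^a$ and $\mathsf D^\dagger=\mathsf D\,\mathfrak H^{1+\sigma}(T^\dagger)^{(n\bmod 2)}$. -/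

import Mathlib

open scoped Matrix

namespace KWIsing

section

variable {L N : ℕ} [NeZero L] [NeZero N]

/-- Basis states `|s⟩` of a periodic chain of `L` qudits of dimension `N`, labelled by the
clock eigenvalues `s j ∈ ℤ/N` at the sites `j ∈ ℤ/L`. -/
abbrev Config (L N : ℕ) : Type := ZMod L → ZMod N

/-- Operators on the Hilbert space `⨂_j ℂ^N`, as matrices in the orthonormal basis `|s⟩`:
`A s' s = ⟨s'| A |s⟩`. The adjoint is the conjugate transpose. -/
abbrev Op (L N : ℕ) : Type := Matrix (Config L N) (Config L N) ℂ

/-- The primitive root of unity `ω = exp (2πi / N)`. -/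
noncomputable def omega (N : ℕ) : ℂ := Complex.exp (2 * Real.pi * Complex.I / N)

/-- The operator sending basis states to basis states: `|s⟩ ↦ |φ s⟩`. -/
def basisMap (φ : Config L N → Config L N) : Op L N :=
  Matrix.of fun s' s => if s' = φ s then 1 else 0

/-- The clock operator `Z_j |s⟩ = ω^(s j) |s⟩`. -/
noncomputable def clock (j : ZMod L) : Op L N :=
  Matrix.diagonal fun s => omega N ^ (s j).val

/-- The shift operator `X_j`, raising `s j` by one. -/
def shift (j : ZMod L) : Op L N :=
  basisMap fun s => s + Pi.single j 1

/-- Lattice translation `T |s⟩ = |s'⟩` with `s' j = s (j + 1)`, so that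
`T X_j T⁻¹ = X_{j-1}` and `T (∏_j X_j^{f_j}) T⁻¹ = ∏_j X_j^{f_{j+1}}`. -/
def translation (L N : ℕ) [NeZero L] : Op L N :=
  basisMap fun s j => s (j + 1)

/-- Charge conjugation `|s⟩ ↦ |-s⟩`. -/
def chargeConj (L N : ℕ) [NeZero L] : Op L N :=
  basisMap fun s => -s

/-- The one-site Hadamard (discrete Fourier) matrix
`|b⟩ ↦ N^{-1/2} ∑_a ω^{-ab} |a⟩`, conjugation by which sends `(X, Z)` to `(Z†, X)`. -/
noncomputable def hadamardSite (N : ℕ) : Matrix (ZMod N) (ZMod N) ℂ :=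
  Matrix.of fun a b => ((Real.sqrt N : ℝ) : ℂ)⁻¹ * omega N ^ (-(a * b)).val

/-- The Hadamard operator of the whole chain, the tensor product over all sites of the one-site
Hadamard matrices. -/
noncomputable def hadamard (L N : ℕ) [NeZero L] : Op L N :=
  Matrix.of fun s' s => ∏ j : ZMod L, hadamardSite N (s' j) (s j)

/-- The product `A_0 A_1 ⋯ A_{L-1}` over the sites of the ring. It is only used for commuting
factors. -/
def siteProd (A : ℕ → Op L N) : Op L N :=
  ((List.range L).map A).prod

/-- `∏_l Z_l^{a_l}` for a `ℤ/N`-valued exponent `a`. -/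
noncomputable def clockProd (a : ZMod L → ZMod N) : Op L N :=
  siteProd fun i => clock (i : ZMod L) ^ (a (i : ZMod L)).val

/-- The coupling matrices of the generalized Ising models: translation invariant on the ring of
`L > n` sites, supported on the `n + 1` sites `j, …, j + n`, with end coefficients
`Δ_{j,j}` and `Δ_{j,j+n}` coprime to `N`. -/
structure IsCoupling (n : ℕ) (Δ : Matrix (ZMod L) (ZMod L) (ZMod N)) : Prop where
  lt_length : n < L
  translation_invariant : ∀ j l k : ZMod L, Δ j l = Δ (j + k) (l + k)
  support : ∀ j l : ZMod L, (∀ k : ℕ, k ≤ n → l ≠ j + k) → Δ j l = 0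
  isUnit_first : ∀ j : ZMod L, IsUnit (Δ j j)
  isUnit_last : ∀ j : ZMod L, IsUnit (Δ j (j + n))

/-- `H = -∑_j { J ∏_l Z_l^{Δ_{j,l}} + h X_j + H.c. }`. -/
noncomputable def hamiltonian (Δ : Matrix (ZMod L) (ZMod L) (ZMod N)) (J h : ℝ) : Op L N :=
  -∑ j : ZMod L,
    (((J : ℂ) • clockProd (Δ j) + (h : ℂ) • shift j) +
      ((J : ℂ) • clockProd (Δ j) + (h : ℂ) • shift j)ᴴ)

/-- `f : ℤ → ℤ/N` is the `q`-th generating lattice function (`q = 0, …, n - 1` here stands for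
`1, …, n`): it solves `Δ_{1,1} f_j + Δ_{1,2} f_{j+1} + ⋯ + Δ_{1,1+n} f_{j+n} = 0` for all `j ∈ ℤ`,
and `f_j = δ_{j,q}` for `j = 1, …, n`. -/
def IsGenerating (n : ℕ) (Δ : Matrix (ZMod L) (ZMod L) (ZMod N)) (q : Fin n)
    (f : ℤ → ZMod N) : Prop :=
  (∀ j : ℤ, ∑ k ∈ Finset.range (n + 1), Δ 1 (1 + (k : ZMod L)) * f (j + k) = 0) ∧
    ∀ i : Fin n, f ((i : ℤ) + 1) = if i = q then 1 else 0

/-- One-sided linear recurrences with invertible leading coefficient have solutions. -/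
theorem exists_forward {R : Type*} [CommRing R] (n : ℕ) (c : ℕ → R) (hc : IsUnit (c n))
    (v : ℕ → R) :
    ∃ F : ℕ → R, (∀ i < n, F i = v i) ∧
      ∀ m, ∑ k ∈ Finset.range (n + 1), c k * F (m + k) = 0 := by
  obtain ⟨u, hu⟩ := hc
  let step : (m : ℕ) → ((i : ℕ) → i < m → R) → R := fun m ih =>
    if m < n then v m
    else -(↑u⁻¹ * ∑ k ∈ Finset.range n,
      c k * (if hk : m - n + k < m then ih (m - n + k) hk else 0))
  let F : ℕ → R := fun m => Nat.strongRec step m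
  have hF : ∀ m, F m = step m (fun i _ => F i) := fun m => by
    simp only [F]; rw [Nat.strongRec]
  refine ⟨F, fun i hi => ?_, fun m => ?_⟩
  · rw [hF]; simp only [step, if_pos hi]
  · rw [Finset.sum_range_succ, hF (m + n)]
    have h1 : ¬ (m + n < n) := by omega
    simp only [step, if_neg h1, Nat.add_sub_cancel]
    have h2 : ∀ k ∈ Finset.range n,
        c k * (if _ : m + k < m + n then F (m + k) else 0) = c k * F (m + k) := by
      intro k hk
      have : m + k < m + n := by have := Finset.mem_range.1 hk; omega
      rw [dif_pos this]
    rw [Finset.sum_congr rfl h2, ← hu, mul_neg, ← mul_assoc, Units.mul_inv, one_mul,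
      add_neg_cancel]

theorem exists_isGenerating {n : ℕ} {Δ : Matrix (ZMod L) (ZMod L) (ZMod N)}
    (hΔ : IsCoupling n Δ) (q : Fin n) : ∃ f, IsGenerating n Δ q f := by
  let c : ℕ → ZMod N := fun k => Δ 1 (1 + (k : ZMod L))
  let v : ℕ → ZMod N := fun i => if i = q then 1 else 0
  obtain ⟨F, hF, hF'⟩ := exists_forward n c (hΔ.isUnit_last 1) v
  have h0 : IsUnit (c (n - n)) := by simpa [c] using hΔ.isUnit_first 1
  obtain ⟨G, hG, hG'⟩ := exists_forward n (fun k => c (n - k)) h0 (fun i => v (n - 1 - i))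
  let f : ℤ → ZMod N := fun j => if 1 ≤ j then F (j - 1).toNat else G (n - j).toNat
  have hf1 : ∀ j : ℤ, 1 ≤ j → f j = F (j - 1).toNat := fun j hj => if_pos hj
  have hf2 : ∀ j : ℤ, j ≤ n → f j = G (n - j).toNat := by
    intro j hj
    by_cases h : 1 ≤ j
    · rw [hf1 j h, hF _ (by omega), hG _ (by omega)]
      congr 1
      omega
    · exact if_neg h
  refine ⟨f, fun j => ?_, fun i => ?_⟩
  · by_cases h : 1 ≤ j
    · rw [← hF' (j - 1).toNat]
      refine Finset.sum_congr rfl fun k _ => ?_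
      rw [hf1 _ (by omega)]
      congr 2
      omega
    · rw [← hG' (-j).toNat, ← Finset.sum_range_reflect]
      refine Finset.sum_congr rfl fun k hk => ?_
      have hk' := Finset.mem_range.1 hk
      rw [hf2 _ (by omega)]
      have e1 : n + 1 - 1 - k = n - k := by omega
      have e2 : ((n : ℤ) - (j + ((n - k : ℕ) : ℤ))).toNat = (-j).toNat + k := by omega
      rw [e1, e2]
  · rw [hf1 _ (by omega), hF _ (by omega)]
    have : ((i : ℤ) + 1 - 1).toNat = i := by omega
    rw [this]
    simp [v, Fin.ext_iff]

/-- The generating lattice functions `f^{(q)} : ℤ → ℤ/N`. -/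
noncomputable def latticeFunction {n : ℕ} {Δ : Matrix (ZMod L) (ZMod L) (ZMod N)}
    (hΔ : IsCoupling n Δ) (q : Fin n) : ℤ → ZMod N :=
  (exists_isGenerating hΔ q).choose

/-- The modulated symmetry operators `U_q = ∏_j X_j^{f_j^{(q)}}`. -/
noncomputable def symOp {n : ℕ} {Δ : Matrix (ZMod L) (ZMod L) (ZMod N)}
    (hΔ : IsCoupling n Δ) (q : Fin n) : Op L N :=
  siteProd fun i => shift (i : ZMod L) ^ (latticeFunction hΔ q i).val

/-- `∏_q ∑_{a=0}^{N-1} U_q^a`. -/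
noncomputable def symSum {n : ℕ} {Δ : Matrix (ZMod L) (ZMod L) (ZMod N)}
    (hΔ : IsCoupling n Δ) : Op L N :=
  (List.ofFn fun q : Fin n => ∑ a ∈ Finset.range N, symOp hΔ q ^ a).prod

/-- The gauging map `|s⟩ ↦ |-Δ s⟩` (with the link `⟨j, j+1⟩` identified with the site `j`). It
intertwines `∏_l Z_l^{Δ_{j,l}}` with `Z_j†` and `X_j†` with `∏_l X_l^{Δᵀ_{j,l}}`. -/
def gaugingMap (Δ : Matrix (ZMod L) (ZMod L) (ZMod N)) : Op L N :=
  basisMap fun s => -(Δ *ᵥ s)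

/-- The Kramers-Wannier operator `D̃_KW`: the gauging map followed by the inverse Hadamard
operator (the Hadamard operator is unitary). -/
noncomputable def kwTilde (Δ : Matrix (ZMod L) (ZMod L) (ZMod N)) : Op L N :=
  (hadamard L N)ᴴ * gaugingMap Δ

/-- `A` implements the Kramers-Wannier transformation:
`A ∏_l Z_l^{Δ_{j,l}} = X_j A` and `A X_j = ∏_l Z_l^{-Δᵀ_{j,l}} A` for every site `j`. -/
def ImplementsKW (Δ : Matrix (ZMod L) (ZMod L) (ZMod N)) (A : Op L N) : Prop :=
  ∀ j : ZMod L,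
    A * clockProd (Δ j) = shift j * A ∧ A * shift j = clockProd (fun l => -Δᵀ j l) * A

/-- `D_KW = T^{-⌊(n+1)/2⌋} D̃_KW`. -/
noncomputable def kw (n : ℕ) (Δ : Matrix (ZMod L) (ZMod L) (ZMod N)) : Op L N :=
  translation L N ^ (-(((n + 1) / 2 : ℕ) : ℤ)) * kwTilde Δ

end

end KWIsing

/-!
All operators in the theorem are explicit kernels in the basis of configurations
`s : ℤ/L → ℤ/N`. The clock and shift products are the phases `ω^{a ⬝ s}` and the displacements
`|s⟩ ↦ |s + v⟩`, while the Hadamard operator, `D̃_KW` and its translates are all of the form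
`⟨m| F_A |s⟩ = N^{-L/2} ω^{-m ⬝ A s}` (`fourierOp A`) for a matrix `A` over `ℤ/N`: the matrix is
`1`, `Δ`, and `T^{-p} Δ` respectively. Then `F_A` turns a displacement by `v` into the phase
`-A v` and the phase `Aᵀ b` into the displacement by `b`, its adjoint is `F_{-Aᵀ}`, and by
orthogonality of characters `⟨m| F_A F_B |s⟩` is `1` if `Aᵀ m + B s = 0` and `0` otherwise
(`fourierOp_mul_fourierOp`).

Reflection symmetry says `Δᵀ = σ T^{-n} Δ`. Hence `A = T^{-p} Δ` satisfies `Aᵀ = σ T^r A` with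
`r = 2 p - n` (`exists_isReflection`), and `r` is `n mod 2` for `p = ⌊(n + 1) / 2⌋` and
`-(n mod 2)` for `p = ⌊n / 2⌋`. The adjoint formula and the symmetry of the Hamiltonian follow by
substitution. For the square, `Aᵀ m + A s = A (σ T^r m + s)` vanishes exactly when
`σ T^r m + s` lies in `ker Δ`. Since `n < L`, a row of `Δ` is a recurrence of order `n` with
invertible end coefficients, so `ker Δ` is freely spanned by the periodic lattice functions
(`eq_sum_smul_ringFunction_iff`), and `∏_q ∑_a U_q^a` is the sum of the displacements by the
elements of `ker Δ` (`symSum_apply`). The remaining sign `-σ` is `hadamard ^ (1 + σ)`, because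
the squared Hadamard operator is charge conjugation (`hadamard_sq`).

For uniqueness, the intertwining relations fix the factor by which a matrix entry changes when
one site of either label is raised; `D̃_KW` has no zero entry, so the ratio of any solution to it
is constant (`ImplementsKW.exists_eq_smul`).
-/

namespace KWIsing

section

variable {L N : ℕ} [NeZero L] [NeZero N]

/-! ### Basis permutations, displacements and phases -/

theorem omega_pow_val (x : ZMod N) : omega N ^ x.val = ZMod.stdAddChar x := by
  have h := ZMod.stdAddChar_coe (N := N) (x.val : ℤ)
  rw [Int.cast_natCast, ZMod.natCast_rightInverse x] at h
  rw [h, omega, ← Complex.exp_nat_mul]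
  congr 1
  push_cast
  ring

omit [NeZero N] in
theorem sum_range_eq_sum_zmod {M : Type*} [AddCommMonoid M] (g : ZMod L → M) :
    ∑ i ∈ Finset.range L, g (i : ZMod L) = ∑ j, g j := by
  refine Finset.sum_bij (fun i _ => (i : ZMod L)) (by simp) ?_ ?_ (by simp)
  · intro a ha b hb hab
    have := (ZMod.natCast_eq_natCast_iff' a b L).1 hab
    rwa [Nat.mod_eq_of_lt (Finset.mem_range.1 ha), Nat.mod_eq_of_lt (Finset.mem_range.1 hb)]
      at this
  · intro j _
    exact ⟨j.val, Finset.mem_range.2 j.val_lt, ZMod.natCast_rightInverse j⟩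

theorem mul_basisMap_apply (M : Op L N) (φ : Config L N → Config L N) (m s : Config L N) :
    (M * basisMap φ) m s = M m (φ s) := by
  simp [Matrix.mul_apply, basisMap]

theorem basisMap_mul_apply (M : Op L N) (φ : Config L N ≃ Config L N) (m s : Config L N) :
    (basisMap φ * M) m s = M (φ.symm m) s := by
  simp [Matrix.mul_apply, basisMap, ← Equiv.symm_apply_eq]

theorem basisMap_mul_basisMap (φ ψ : Config L N → Config L N) :
    basisMap φ * basisMap ψ = basisMap (φ ∘ ψ) := by
  ext m s
  rw [mul_basisMap_apply]
  rfl

omit [NeZero N] in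
theorem basisMap_id : basisMap (id : Config L N → Config L N) = 1 := by
  ext m s
  simp [basisMap, Matrix.one_apply]

omit [NeZero N] in
theorem conjTranspose_basisMap (φ : Config L N ≃ Config L N) :
    (basisMap φ)ᴴ = basisMap φ.symm := by
  ext m s
  simp [basisMap, Matrix.conjTranspose_apply, Equiv.eq_symm_apply, eq_comm]

/-- The displacement operator `|s⟩ ↦ |s + v⟩`, that is `∏_j X_j^{v_j}`. -/
def displacement (v : Config L N) : Op L N := basisMap (Equiv.addRight v)

/-- The phase operator `|s⟩ ↦ ω^{a ⬝ s} |s⟩`, that is `∏_j Z_j^{a_j}`. -/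
noncomputable def phase (a : Config L N) : Op L N :=
  Matrix.diagonal fun s => ZMod.stdAddChar (a ⬝ᵥ s)

theorem displacement_mul_apply (v : Config L N) (M : Op L N) (m s : Config L N) :
    (displacement v * M) m s = M (m - v) s := by
  rw [displacement, basisMap_mul_apply]
  simp [sub_eq_add_neg]

theorem mul_displacement_apply (v : Config L N) (M : Op L N) (m s : Config L N) :
    (M * displacement v) m s = M m (s + v) := by
  rw [displacement, mul_basisMap_apply]
  simp

theorem phase_mul_apply (a : Config L N) (M : Op L N) (m s : Config L N) :
    (phase a * M) m s = ZMod.stdAddChar (a ⬝ᵥ m) * M m s := by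
  rw [phase, Matrix.diagonal_mul]

theorem mul_phase_apply (a : Config L N) (M : Op L N) (m s : Config L N) :
    (M * phase a) m s = M m s * ZMod.stdAddChar (a ⬝ᵥ s) := by
  rw [phase, Matrix.mul_diagonal]

omit [NeZero N] in
theorem displacement_zero : displacement (0 : Config L N) = 1 := by
  rw [displacement, ← basisMap_id]
  congr 1
  ext s
  simp

theorem displacement_mul_displacement (v w : Config L N) :
    displacement v * displacement w = displacement (v + w) := by
  rw [displacement, displacement, basisMap_mul_basisMap, displacement]
  congr 1
  funext s
  simp only [Function.comp_apply, Equiv.coe_addRight]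
  abel

theorem displacement_pow (v : Config L N) (k : ℕ) :
    displacement v ^ k = displacement (k • v) := by
  induction k with
  | zero => rw [pow_zero, zero_smul, displacement_zero]
  | succ k ih => rw [pow_succ, ih, displacement_mul_displacement, succ_nsmul]

omit [NeZero N] in
theorem conjTranspose_displacement (v : Config L N) :
    (displacement v)ᴴ = displacement (-v) := by
  rw [displacement, conjTranspose_basisMap, displacement]
  congr 1

theorem conjTranspose_phase (a : Config L N) : (phase a)ᴴ = phase (-a) := by
  rw [phase, phase, Matrix.diagonal_conjTranspose]
  congr 1
  funext s
  rw [neg_dotProduct, AddChar.map_neg_eq_conj]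
  rfl

theorem phase_mul_phase (a b : Config L N) : phase a * phase b = phase (a + b) := by
  rw [phase, phase, phase, Matrix.diagonal_mul_diagonal]
  congr 1
  funext s
  rw [add_dotProduct, AddChar.map_add_eq_mul]

theorem phase_zero : phase (0 : Config L N) = 1 := by
  simp [phase]

theorem phase_pow (a : Config L N) (k : ℕ) : phase a ^ k = phase (k • a) := by
  induction k with
  | zero => rw [pow_zero, zero_smul, phase_zero]
  | succ k ih => rw [pow_succ, ih, phase_mul_phase, succ_nsmul]

omit [NeZero N] in
theorem shift_eq_displacement (j : ZMod L) :
    (shift j : Op L N) = displacement (Pi.single j 1) := rfl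

theorem clock_eq_phase (j : ZMod L) : (clock j : Op L N) = phase (Pi.single j 1) := by
  rw [clock, phase]
  congr 1
  funext s
  rw [omega_pow_val, single_dotProduct, one_mul]

omit [NeZero L] in
theorem val_nsmul_single (j : ZMod L) (x : ZMod N) :
    x.val • (Pi.single j 1 : Config L N) = Pi.single j x := by
  rw [← Pi.single_smul, nsmul_eq_mul, mul_one, ZMod.natCast_rightInverse]

omit [NeZero N] in
theorem sum_range_single (a : Config L N) :
    ∑ i ∈ Finset.range L, Pi.single (i : ZMod L) (a (i : ZMod L)) = a := by
  rw [sum_range_eq_sum_zmod (fun j : ZMod L => (Pi.single j (a j) : Config L N)),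
    Finset.univ_sum_single]

theorem siteProd_shift_pow (a : Config L N) :
    (siteProd fun i => shift (i : ZMod L) ^ (a (i : ZMod L)).val) = displacement a := by
  have key : ∀ k : ℕ, ((List.range k).map fun i : ℕ =>
      (shift (i : ZMod L) : Op L N) ^ (a (i : ZMod L)).val).prod =
        displacement (∑ i ∈ Finset.range k, Pi.single (i : ZMod L) (a (i : ZMod L))) := by
    intro k
    induction k with
    | zero => simp [displacement_zero]
    | succ k ih =>
      rw [List.range_succ, List.map_append, List.prod_append, ih, List.map_singleton,
        List.prod_singleton, shift_eq_displacement, displacement_pow, val_nsmul_single,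
        displacement_mul_displacement, Finset.sum_range_succ]
  rw [siteProd, key, sum_range_single]

theorem clockProd_eq_phase (a : Config L N) : clockProd a = phase a := by
  have key : ∀ k : ℕ, ((List.range k).map fun i : ℕ =>
      (clock (i : ZMod L) : Op L N) ^ (a (i : ZMod L)).val).prod =
        phase (∑ i ∈ Finset.range k, Pi.single (i : ZMod L) (a (i : ZMod L))) := by
    intro k
    induction k with
    | zero => simp [phase_zero]
    | succ k ih =>
      rw [List.range_succ, List.map_append, List.prod_append, ih, List.map_singleton,
        List.prod_singleton, clock_eq_phase, phase_pow, val_nsmul_single,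
        phase_mul_phase, Finset.sum_range_succ]
  rw [clockProd, siteProd, key, sum_range_single]

/-! ### Translations and charge conjugation -/

/-- The `k`-fold translation of configurations, `(rotate k s) j = s (j + k)`. -/
def rotate (k : ZMod L) : Config L N ≃ Config L N :=
  (Equiv.addRight (-k)).arrowCongr (Equiv.refl _)

omit [NeZero L] [NeZero N] in
theorem rotate_apply (k : ZMod L) (s : Config L N) (j : ZMod L) : rotate k s j = s (j + k) := by
  simp [rotate, Equiv.arrowCongr]

omit [NeZero L] [NeZero N] in
theorem rotate_symm (k : ZMod L) : (rotate k : Config L N ≃ Config L N).symm = rotate (-k) := by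
  ext s j
  simp [rotate, Equiv.arrowCongr]

omit [NeZero N] in
theorem translation_eq : translation L N = basisMap (rotate 1) := by
  rw [translation]
  congr 1
  funext s j
  rw [rotate_apply]

theorem translation_pow (k : ℕ) : translation L N ^ k = basisMap (rotate (k : ZMod L)) := by
  induction k with
  | zero =>
    rw [pow_zero, ← basisMap_id]
    congr 1
    funext s j
    simp [rotate_apply]
  | succ k ih =>
    rw [pow_succ, ih, translation_eq, basisMap_mul_basisMap]
    congr 1
    funext s j
    simp only [Function.comp_apply, rotate_apply]
    push_cast
    rw [add_assoc]

theorem conjTranspose_translation_pow (k : ℕ) :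
    (translation L N)ᴴ ^ k = basisMap (rotate (-(k : ZMod L))) := by
  rw [← Matrix.conjTranspose_pow, translation_pow, conjTranspose_basisMap, rotate_symm]

theorem translation_zpow_neg (k : ℕ) :
    translation L N ^ (-(k : ℤ)) = basisMap (rotate (-(k : ZMod L))) := by
  rw [Matrix.zpow_neg_natCast, translation_pow]
  refine Matrix.inv_eq_right_inv ?_
  rw [basisMap_mul_basisMap, ← rotate_symm, ← basisMap_id]
  congr 1
  funext s
  simp

theorem chargeConj_mul_shift (j : ZMod L) :
    (chargeConj L N : Op L N) * shift j = (shift j)ᴴ * chargeConj L N := by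
  rw [shift_eq_displacement, conjTranspose_displacement]
  simp only [chargeConj, displacement]
  rw [basisMap_mul_basisMap, basisMap_mul_basisMap]
  congr 1
  funext s
  simp [add_comm]

theorem chargeConj_mul_clock (j : ZMod L) :
    (chargeConj L N : Op L N) * clock j = (clock j)ᴴ * chargeConj L N := by
  rw [clock_eq_phase, conjTranspose_phase]
  ext m s
  rw [mul_phase_apply, phase_mul_apply]
  simp only [chargeConj, basisMap, Matrix.of_apply]
  split_ifs with h
  · subst h; simp
  · simp

/-! ### Fourier kernels of matrices over `ℤ/N` -/

/-- The operator with kernel `⟨m| F_A |s⟩ = N^{-L/2} ω^{-m ⬝ A s}`: the map `|s⟩ ↦ |-A s⟩` followed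
by the inverse Fourier transform of the whole chain. -/
noncomputable def fourierOp (A : Matrix (ZMod L) (ZMod L) (ZMod N)) : Op L N :=
  Matrix.of fun m s => (((Real.sqrt N : ℝ) : ℂ)⁻¹) ^ L * ZMod.stdAddChar (-(m ⬝ᵥ A *ᵥ s))

theorem fourierOp_apply (A : Matrix (ZMod L) (ZMod L) (ZMod N)) (m s : Config L N) :
    fourierOp A m s =
      (((Real.sqrt N : ℝ) : ℂ)⁻¹) ^ L * ZMod.stdAddChar (-(m ⬝ᵥ A *ᵥ s)) := rfl

omit [NeZero L] in
theorem stdAddChar_ne_zero (x : ZMod N) : (ZMod.stdAddChar x : ℂ) ≠ 0 := by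
  intro h
  have := AddChar.map_add_eq_mul (ZMod.stdAddChar : AddChar (ZMod N) ℂ) x (-x)
  rw [add_neg_cancel, AddChar.map_zero_eq_one, h, zero_mul] at this
  exact one_ne_zero this

theorem stdAddChar_sum {ι : Type*} (t : Finset ι) (g : ι → ZMod N) :
    (ZMod.stdAddChar (∑ i ∈ t, g i) : ℂ) = ∏ i ∈ t, (ZMod.stdAddChar (g i) : ℂ) := by
  classical
  induction t using Finset.induction_on with
  | empty => simp
  | insert a t ha ih => rw [Finset.sum_insert ha, Finset.prod_insert ha,
      AddChar.map_add_eq_mul, ih]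

theorem hadamard_eq_fourierOp : hadamard L N = fourierOp 1 := by
  ext m s
  rw [fourierOp_apply, Matrix.one_mulVec]
  simp only [hadamard, hadamardSite, Matrix.of_apply]
  rw [Finset.prod_mul_distrib, Finset.prod_const, Finset.card_univ, ZMod.card, dotProduct,
    ← Finset.sum_neg_distrib, stdAddChar_sum]
  simp only [omega_pow_val]

theorem kwTilde_eq_fourierOp (Δ : Matrix (ZMod L) (ZMod L) (ZMod N)) :
    kwTilde Δ = fourierOp Δ := by
  ext m s
  rw [kwTilde, gaugingMap, mul_basisMap_apply, Matrix.conjTranspose_apply,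
    hadamard_eq_fourierOp, fourierOp_apply, fourierOp_apply, Matrix.one_mulVec, neg_dotProduct,
    neg_neg, star_mul', star_pow, star_inv₀, dotProduct_comm, AddChar.map_neg_eq_conj]
  congr 3
  exact Complex.conj_ofReal _

/-- Orthogonality of the characters of `(ℤ/N)^L`. -/
theorem sum_stdAddChar_dotProduct (v : Config L N) :
    ∑ t : Config L N, (ZMod.stdAddChar (t ⬝ᵥ v) : ℂ) = if v = 0 then (N : ℂ) ^ L else 0 := by
  have h1 : ∀ t : Config L N, (ZMod.stdAddChar (t ⬝ᵥ v) : ℂ) =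
      ∏ j, ZMod.stdAddChar (t j * v j) := fun t => stdAddChar_sum _ _
  have h2 := Finset.prod_univ_sum (fun _ : ZMod L => (Finset.univ : Finset (ZMod N)))
    (fun j x => (ZMod.stdAddChar (x * v j) : ℂ))
  rw [Fintype.piFinset_univ] at h2
  simp only [h1]
  rw [← h2]
  simp only [AddChar.sum_mulShift _ (ZMod.isPrimitive_stdAddChar N), ZMod.card]
  split_ifs with h
  · subst h
    simp [ZMod.card]
  · obtain ⟨j, hj⟩ := Function.ne_iff.1 h
    exact Finset.prod_eq_zero (Finset.mem_univ j) (by simpa [NeZero.ne N] using hj)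

omit [NeZero L] in
theorem inv_sqrt_pow_mul_self :
    ((((Real.sqrt N : ℝ) : ℂ)⁻¹) ^ L * (((Real.sqrt N : ℝ) : ℂ)⁻¹) ^ L) * (N : ℂ) ^ L = 1 := by
  have h : ((Real.sqrt N : ℝ) : ℂ) * ((Real.sqrt N : ℝ) : ℂ) = N := by
    rw [← Complex.ofReal_mul, Real.mul_self_sqrt (Nat.cast_nonneg _), Complex.ofReal_natCast]
  have hN : (N : ℂ) ≠ 0 := Nat.cast_ne_zero.2 (NeZero.ne N)
  rw [← mul_pow, ← mul_pow, ← mul_inv, h, inv_mul_cancel₀ hN, one_pow]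

theorem fourierOp_mul_fourierOp (A B : Matrix (ZMod L) (ZMod L) (ZMod N)) (m s : Config L N) :
    (fourierOp A * fourierOp B) m s = if Aᵀ *ᵥ m + B *ᵥ s = 0 then 1 else 0 := by
  have h1 : ∀ t : Config L N, fourierOp A m t * fourierOp B t s =
      ((((Real.sqrt N : ℝ) : ℂ)⁻¹) ^ L * (((Real.sqrt N : ℝ) : ℂ)⁻¹) ^ L) *
        ZMod.stdAddChar (t ⬝ᵥ -(Aᵀ *ᵥ m + B *ᵥ s)) := by
    intro t
    have : t ⬝ᵥ -(Aᵀ *ᵥ m + B *ᵥ s) = -(m ⬝ᵥ A *ᵥ t) + -(t ⬝ᵥ B *ᵥ s) := by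
      rw [dotProduct_neg, dotProduct_add, Matrix.mulVec_transpose, Matrix.dotProduct_mulVec m,
        dotProduct_comm t, neg_add]
    rw [this, AddChar.map_add_eq_mul, fourierOp_apply, fourierOp_apply]
    ring
  rw [Matrix.mul_apply, Finset.sum_congr rfl fun t _ => h1 t, ← Finset.mul_sum,
    sum_stdAddChar_dotProduct]
  simp only [neg_eq_zero]
  split_ifs
  · exact inv_sqrt_pow_mul_self
  · exact mul_zero _

theorem conjTranspose_fourierOp (A : Matrix (ZMod L) (ZMod L) (ZMod N)) :
    (fourierOp A)ᴴ = fourierOp (-Aᵀ) := by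
  ext m s
  rw [Matrix.conjTranspose_apply, fourierOp_apply, fourierOp_apply, star_mul', star_pow,
    star_inv₀, Matrix.neg_mulVec, dotProduct_neg, neg_neg, AddChar.map_neg_eq_conj,
    Matrix.mulVec_transpose, dotProduct_comm m, ← Matrix.dotProduct_mulVec]
  congr 3
  · exact Complex.conj_ofReal _
  · exact star_star _

theorem hadamard_sq : hadamard L N ^ 2 = chargeConj L N := by
  ext m s
  rw [sq, hadamard_eq_fourierOp, fourierOp_mul_fourierOp]
  simp [chargeConj, basisMap, add_eq_zero_iff_eq_neg]

theorem basisMap_rotate_mul_fourierOp (k : ZMod L) (A : Matrix (ZMod L) (ZMod L) (ZMod N)) :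
    basisMap (rotate k) * fourierOp A = fourierOp (A.submatrix (fun j => j + k) id) := by
  ext m s
  rw [basisMap_mul_apply, fourierOp_apply, fourierOp_apply]
  congr 3
  rw [rotate_symm, dotProduct, dotProduct, ← Equiv.sum_comp (Equiv.addRight k)]
  refine Finset.sum_congr rfl fun j _ => ?_
  simp [rotate_apply, Matrix.mulVec, dotProduct]

theorem fourierOp_mul_displacement (A : Matrix (ZMod L) (ZMod L) (ZMod N)) (v : Config L N) :
    fourierOp A * displacement v = phase (-(A *ᵥ v)) * fourierOp A := by
  ext m s
  rw [mul_displacement_apply, phase_mul_apply, fourierOp_apply, fourierOp_apply,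
    Matrix.mulVec_add, dotProduct_add, neg_add, AddChar.map_add_eq_mul, neg_dotProduct,
    dotProduct_comm m (A *ᵥ v)]
  ring

theorem fourierOp_mul_phase (A : Matrix (ZMod L) (ZMod L) (ZMod N)) (b : Config L N) :
    fourierOp A * phase (Aᵀ *ᵥ b) = displacement b * fourierOp A := by
  ext m s
  rw [mul_phase_apply, displacement_mul_apply, fourierOp_apply, fourierOp_apply,
    sub_dotProduct, neg_sub, sub_eq_neg_add, AddChar.map_add_eq_mul, Matrix.mulVec_transpose,
    ← Matrix.dotProduct_mulVec]
  ring

theorem fourierOp_mul_phase_row (A : Matrix (ZMod L) (ZMod L) (ZMod N)) (k : ZMod L) :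
    fourierOp A * phase (A k) = displacement (Pi.single k 1) * fourierOp A := by
  rw [← fourierOp_mul_phase, Matrix.mulVec_single_one]
  rfl

theorem fourierOp_mul_phase_neg_row (A : Matrix (ZMod L) (ZMod L) (ZMod N)) (k : ZMod L) :
    fourierOp A * phase (-A k) = displacement (-Pi.single k 1) * fourierOp A := by
  rw [← fourierOp_mul_phase, Matrix.mulVec_neg, Matrix.mulVec_single_one]
  rfl

/-! ### The Kramers-Wannier intertwiner and its uniqueness -/

theorem implementsKW_fourierOp (Δ : Matrix (ZMod L) (ZMod L) (ZMod N)) :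
    ImplementsKW Δ (fourierOp Δ) := by
  intro j
  rw [clockProd_eq_phase, clockProd_eq_phase, shift_eq_displacement]
  refine ⟨fourierOp_mul_phase_row Δ j, ?_⟩
  rw [fourierOp_mul_displacement, Matrix.mulVec_single_one]
  rfl

/-- A function on configurations that is invariant under raising any single site is constant. -/
theorem eq_of_single_invariant {M : Type*} (g : Config L N → M)
    (hg : ∀ (j : ZMod L) (s : Config L N), g (s + Pi.single j 1) = g s) (s : Config L N) :
    g s = g 0 := by
  have h : ∀ v s : Config L N, g (s + v) = g s := by
    intro v
    induction v using Pi.single_induction with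
    | zero => intro s; rw [add_zero]
    | add f f' hf hf' => intro s; rw [← add_assoc, hf', hf]
    | single j x =>
      rw [← val_nsmul_single]
      induction x.val with
      | zero => intro s; rw [zero_smul, add_zero]
      | succ k ih => intro s; rw [succ_nsmul, ← add_assoc, hg, ih]
  simpa using h s 0

/-- The relations determine how each matrix entry changes when a site of either label is raised,
hence the ratio of any solution to the nowhere vanishing kernel of `fourierOp Δ` is constant. -/
theorem ImplementsKW.exists_eq_smul {Δ : Matrix (ZMod L) (ZMod L) (ZMod N)} {A : Op L N}
    (hA : ImplementsKW Δ A) : ∃ c : ℂ, A = c • fourierOp Δ := by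
  have hne : ∀ m s, fourierOp Δ m s ≠ 0 := fun m s => by
    rw [fourierOp_apply]
    refine mul_ne_zero (pow_ne_zero _ (inv_ne_zero ?_)) ?_
    · exact Complex.ofReal_ne_zero.2 (Real.sqrt_ne_zero'.2 (Nat.cast_pos.2 (NeZero.pos N)))
    · exact stdAddChar_ne_zero _
  have hrow : ∀ B : Op L N, ImplementsKW Δ B → ∀ j m s,
      B m s = B (m + Pi.single j 1) s * ZMod.stdAddChar (Δ j ⬝ᵥ s) := by
    intro B hB j m s
    have := congrFun (congrFun (hB j).1 (m + Pi.single j 1)) s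
    rw [clockProd_eq_phase, mul_phase_apply, shift_eq_displacement, displacement_mul_apply,
      add_sub_cancel_right] at this
    exact this.symm
  have hcol : ∀ B : Op L N, ImplementsKW Δ B → ∀ j m s,
      B m (s + Pi.single j 1) = ZMod.stdAddChar ((fun l => -Δᵀ j l) ⬝ᵥ m) * B m s := by
    intro B hB j m s
    have := congrFun (congrFun (hB j).2 m) s
    rwa [clockProd_eq_phase, phase_mul_apply, shift_eq_displacement, mul_displacement_apply]
      at this
  have hF := implementsKW_fourierOp Δ
  refine ⟨A 0 0 / fourierOp Δ 0 0, ?_⟩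
  ext m s
  have h1 : A m s / fourierOp Δ m s = A m 0 / fourierOp Δ m 0 :=
    eq_of_single_invariant (fun s => A m s / fourierOp Δ m s) (fun j s => by
      rw [hcol A hA, hcol _ hF, mul_div_mul_left _ _ (stdAddChar_ne_zero _)]) s
  have h2 : A m 0 / fourierOp Δ m 0 = A 0 0 / fourierOp Δ 0 0 :=
    eq_of_single_invariant (fun m => A m 0 / fourierOp Δ m 0) (fun j m => by
      rw [hrow A hA j m, hrow _ hF j m, mul_div_mul_right _ _ (stdAddChar_ne_zero _)]) m
  rw [Matrix.smul_apply, smul_eq_mul, ← h2, ← h1, div_mul_cancel₀ _ (hne m s)]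

/-! ### Lattice functions span the kernel of the coupling matrix -/

section Kernel

variable {n : ℕ} {Δ : Matrix (ZMod L) (ZMod L) (ZMod N)}

omit [NeZero N] in
/-- Because `n < L`, the sites `j, …, j + n` are distinct, so a row of `Δ` is a recurrence with
`n + 1` coefficients. -/
theorem IsCoupling.mulVec_apply (hΔ : IsCoupling n Δ) (v : Config L N) (j : ZMod L) :
    (Δ *ᵥ v) j = ∑ k ∈ Finset.range (n + 1), Δ 1 (1 + (k : ZMod L)) * v (j + k) := by
  have hinj : Set.InjOn (fun k : ℕ => j + (k : ZMod L)) (Finset.range (n + 1) : Finset ℕ) := by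
    intro a ha b hb hab
    have hlt := hΔ.lt_length
    have ha' := Finset.mem_range.1 (Finset.mem_coe.1 ha)
    have hb' := Finset.mem_range.1 (Finset.mem_coe.1 hb)
    have := (ZMod.natCast_eq_natCast_iff' a b L).1 (add_left_cancel hab)
    rwa [Nat.mod_eq_of_lt (by omega), Nat.mod_eq_of_lt (by omega)] at this
  have h1 : ∀ k : ℕ, Δ 1 (1 + (k : ZMod L)) = Δ j (j + k) := by
    intro k
    rw [hΔ.translation_invariant 1 _ (j - 1)]
    congr 1 <;> ring
  simp only [h1]
  rw [← Finset.sum_image (f := fun l => Δ j l * v l) hinj, Matrix.mulVec, dotProduct]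
  refine (Finset.sum_subset (Finset.subset_univ _) fun l _ hl => ?_).symm
  rw [hΔ.support j l, zero_mul]
  rintro k hk rfl
  exact hl (Finset.mem_image.2 ⟨k, Finset.mem_range.2 (by omega), rfl⟩)

omit [NeZero N] in
/-- A kernel vector that vanishes on the sites `1, …, n` is zero: the last coefficient of the
recurrence is invertible, so the zeros propagate around the ring. -/
theorem IsCoupling.eq_zero_of_mulVec_eq_zero (hΔ : IsCoupling n Δ) {v : Config L N}
    (hv : Δ *ᵥ v = 0) (h0 : ∀ i : ℕ, i < n → v ((i : ZMod L) + 1) = 0) : v = 0 := by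
  have key : ∀ i : ℕ, v ((i : ZMod L) + 1) = 0 := by
    intro i
    induction i using Nat.strong_induction_on with
    | _ i ih =>
      by_cases hi : i < n
      · exact h0 i hi
      · have h := congrFun hv (((i - n : ℕ) : ZMod L) + 1)
        have e : ∀ k : ℕ, ((i - n : ℕ) : ZMod L) + 1 + (k : ZMod L) =
            ((i - n + k : ℕ) : ZMod L) + 1 := by
          intro k; push_cast; ring
        rw [hΔ.mulVec_apply, Finset.sum_range_succ, Finset.sum_eq_zero, zero_add, Pi.zero_apply,
          e, Nat.sub_add_cancel (not_lt.1 hi)] at h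
        · exact ((hΔ.isUnit_last 1).mul_right_eq_zero).1 h
        · intro k hk
          have := Finset.mem_range.1 hk
          rw [e, ih _ (by omega), mul_zero]
  funext j
  have := key (j - 1).val
  rwa [ZMod.natCast_rightInverse, sub_add_cancel] at this

/-- The lattice function `f^{(q)}` as a configuration on the ring. -/
noncomputable def ringFunction (hΔ : IsCoupling n Δ) (q : Fin n) : Config L N :=
  fun j => latticeFunction hΔ q j.val

theorem symOp_eq_displacement (hΔ : IsCoupling n Δ) (q : Fin n) :
    symOp hΔ q = displacement (ringFunction hΔ q) := by
  rw [← siteProd_shift_pow, symOp, siteProd, siteProd]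
  congr 1
  refine List.map_congr_left fun i hi => ?_
  rw [ringFunction, ZMod.val_cast_of_lt (List.mem_range.1 hi)]

theorem ringFunction_intCast (hΔ : IsCoupling n Δ)
    (hper : ∀ (q : Fin n) (j : ℤ), latticeFunction hΔ q (j + L) = latticeFunction hΔ q j)
    (q : Fin n) (z : ℤ) : ringFunction hΔ q (z : ZMod L) = latticeFunction hΔ q z := by
  have hp : Function.Periodic (latticeFunction hΔ q) (L : ℤ) := hper q
  have h := hp.int_mul (z / L) (z % L)
  rw [ringFunction, ZMod.val_intCast, ← h]
  congr 1
  simp only [Int.cast_id]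
  rw [mul_comm, Int.emod_add_mul_ediv]

theorem mulVec_ringFunction (hΔ : IsCoupling n Δ)
    (hper : ∀ (q : Fin n) (j : ℤ), latticeFunction hΔ q (j + L) = latticeFunction hΔ q j)
    (q : Fin n) : Δ *ᵥ ringFunction hΔ q = 0 := by
  have hgen : IsGenerating n Δ q (latticeFunction hΔ q) := (exists_isGenerating hΔ q).choose_spec
  funext j
  rw [hΔ.mulVec_apply, Pi.zero_apply, ← hgen.1 (j.val : ℤ)]
  refine Finset.sum_congr rfl fun k _ => ?_
  rw [← ringFunction_intCast hΔ hper]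
  push_cast
  rw [ZMod.natCast_rightInverse]

theorem ringFunction_apply (hΔ : IsCoupling n Δ)
    (hper : ∀ (q : Fin n) (j : ℤ), latticeFunction hΔ q (j + L) = latticeFunction hΔ q j)
    (q i : Fin n) : ringFunction hΔ q (((i : ℕ) : ZMod L) + 1) = if i = q then 1 else 0 := by
  have hgen : IsGenerating n Δ q (latticeFunction hΔ q) := (exists_isGenerating hΔ q).choose_spec
  rw [← hgen.2 i, ← ringFunction_intCast hΔ hper]
  push_cast
  rfl

/-- A kernel vector is a unique combination of the lattice functions, with its values at the sites
`1, …, n` as coefficients. -/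
theorem eq_sum_smul_ringFunction_iff (hΔ : IsCoupling n Δ)
    (hper : ∀ (q : Fin n) (j : ℤ), latticeFunction hΔ q (j + L) = latticeFunction hΔ q j)
    (v : Config L N) (a : Fin n → ZMod N) :
    v = ∑ q, a q • ringFunction hΔ q ↔
      Δ *ᵥ v = 0 ∧ a = fun i : Fin n => v (((i : ℕ) : ZMod L) + 1) := by
  have hker : ∀ a : Fin n → ZMod N, Δ *ᵥ (∑ q, a q • ringFunction hΔ q) = 0 := by
    intro a
    rw [Matrix.mulVec_sum]
    refine Finset.sum_eq_zero fun q _ => ?_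
    rw [Matrix.mulVec_smul, mulVec_ringFunction hΔ hper, smul_zero]
  have hval : ∀ (a : Fin n → ZMod N) (i : Fin n),
      (∑ q, a q • ringFunction hΔ q) (((i : ℕ) : ZMod L) + 1) = a i := by
    intro a i
    rw [Finset.sum_apply]
    simp [ringFunction_apply hΔ hper]
  constructor
  · rintro rfl
    exact ⟨hker a, funext fun i => (hval a i).symm⟩
  · rintro ⟨hv, rfl⟩
    refine sub_eq_zero.1 (hΔ.eq_zero_of_mulVec_eq_zero ?_ fun i hi => ?_)
    · rw [Matrix.mulVec_sub, hv, hker, sub_zero]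
    · rw [Pi.sub_apply, hval _ ⟨i, hi⟩, sub_self]

omit [NeZero L] in
theorem sum_range_nsmul {M : Type*} [AddCommMonoid M] (g : Config L N → M) (f : Config L N) :
    ∑ a ∈ Finset.range N, g (a • f) = ∑ a : ZMod N, g (a • f) := by
  rw [← sum_range_eq_sum_zmod]
  simp only [Nat.cast_smul_eq_nsmul]

/-- The product of the `k` sums of powers expands into one sum over all coefficient vectors. -/
theorem prod_sum_displacement_pow (k : ℕ) (f : Fin k → Config L N) :
    (List.ofFn fun q => ∑ a ∈ Finset.range N, displacement (f q) ^ a).prod =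
      ∑ a : Fin k → ZMod N, displacement (∑ q, a q • f q) := by
  induction k with
  | zero => simp [displacement_zero]
  | succ k ih =>
    rw [List.ofFn_succ, List.prod_cons, ih]
    simp only [displacement_pow]
    rw [sum_range_nsmul (fun v => displacement v), Finset.sum_mul_sum,
      ← (Fin.consEquiv fun _ => ZMod N).sum_comp, Fintype.sum_prod_type]
    refine Finset.sum_congr rfl fun x _ => Finset.sum_congr rfl fun a _ => ?_
    rw [displacement_mul_displacement, Fin.sum_univ_succ]
    simp [Fin.consEquiv]

/-- `∏_q ∑_a U_q^a` is the sum of the displacements by all vectors of `ker Δ`. -/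
theorem symSum_apply (hΔ : IsCoupling n Δ)
    (hper : ∀ (q : Fin n) (j : ℤ), latticeFunction hΔ q (j + L) = latticeFunction hΔ q j)
    (m s : Config L N) : symSum hΔ m s = if Δ *ᵥ (m - s) = 0 then 1 else 0 := by
  have h1 : ∀ a : Fin n → ZMod N, displacement (∑ q, a q • ringFunction hΔ q) m s =
      if Δ *ᵥ (m - s) = 0 then
        if a = (fun i : Fin n => (m - s) (((i : ℕ) : ZMod L) + 1)) then (1 : ℂ) else 0
      else 0 := by
    intro a
    rw [← ite_and]
    simp only [← eq_sum_smul_ringFunction_iff hΔ hper]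
    simp only [displacement, basisMap, Matrix.of_apply, Equiv.coe_addRight, sub_eq_iff_eq_add']
    congr
  simp only [symSum, symOp_eq_displacement]
  rw [prod_sum_displacement_pow, Matrix.sum_apply, Finset.sum_congr rfl fun a _ => h1 a]
  split_ifs <;> simp

end Kernel

/-! ### The operator algebra -/

/-- The part of the hypotheses on `A = T^{-p} Δ` that the algebra of `fourierOp A` rests on: its
rows are the rows of `Δ` moved by `p`, it commutes with translations, and its transpose is
`σ T^r A`. -/
structure IsReflection (Δ A : Matrix (ZMod L) (ZMod L) (ZMod N)) (p r : ZMod L) (σ : ℤ) :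
    Prop where
  row : ∀ j, A j = Δ (j - p)
  translation_invariant : ∀ j l k, A j l = A (j + k) (l + k)
  transpose : ∀ j l, A l j = (σ : ZMod N) * A (j + r) l

namespace IsReflection

variable {Δ A : Matrix (ZMod L) (ZMod L) (ZMod N)} {p r : ZMod L} {σ : ℤ}

omit [NeZero N] in
theorem mulVec_eq_zero_iff (h : IsReflection Δ A p r σ) (v : Config L N) :
    A *ᵥ v = 0 ↔ Δ *ᵥ v = 0 := by
  have hrow : ∀ j, (A *ᵥ v) j = (Δ *ᵥ v) (j - p) := fun j => by
    rw [Matrix.mulVec, h.row]; rfl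
  constructor <;> intro h0 <;> funext j
  · have := congrFun h0 (j + p)
    rwa [hrow, add_sub_cancel_right] at this
  · rw [hrow, h0]; rfl

omit [NeZero N] in
theorem transpose_mulVec (h : IsReflection Δ A p r σ) (v : Config L N) :
    Aᵀ *ᵥ v = (σ : ZMod N) • (A *ᵥ rotate r v) := by
  funext j
  rw [Pi.smul_apply, Matrix.mulVec, Matrix.mulVec, dotProduct, dotProduct, smul_eq_mul,
    Finset.mul_sum, ← Equiv.sum_comp (Equiv.addRight r)]
  refine Finset.sum_congr rfl fun l _ => ?_
  rw [Matrix.transpose_apply, Equiv.coe_addRight, rotate_apply, ← mul_assoc, h.transpose,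
    ← h.translation_invariant]

/-- Row phases and single-site shifts are exchanged up to sign, which the Hermitian conjugate
terms of the Hamiltonian absorb. -/
theorem commute_hamiltonian (h : IsReflection Δ A p r σ) (hσ : σ = 1 ∨ σ = -1) (J : ℝ) :
    Commute (fourierOp A) (hamiltonian Δ J J) := by
  have hH : hamiltonian Δ J J = -((J : ℂ) • (∑ j, (phase (A j) + phase (-A j)) +
      ∑ j, (displacement (Pi.single j 1) + displacement (-Pi.single j 1)))) := by
    have hrow : ∑ j, (phase (A j) + phase (-A j)) = ∑ j, (phase (Δ j) + phase (-Δ j)) := by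
      rw [← (Equiv.subRight p).sum_comp fun j => phase (Δ j) + phase (-Δ j)]
      simp only [h.row, Equiv.subRight_apply]
    rw [hrow, ← Finset.sum_add_distrib, Finset.smul_sum, hamiltonian]
    congr 1
    refine Finset.sum_congr rfl fun j _ => ?_
    rw [clockProd_eq_phase, shift_eq_displacement, ← smul_add, Matrix.conjTranspose_smul,
      Matrix.conjTranspose_add, conjTranspose_phase, conjTranspose_displacement,
      show star (J : ℂ) = J from Complex.conj_ofReal J, ← smul_add]
    congr 1
    abel
  have h1 : fourierOp A * ∑ j, (phase (A j) + phase (-A j)) =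
      (∑ j, (displacement (Pi.single j 1) + displacement (-Pi.single j 1))) * fourierOp A := by
    rw [Finset.mul_sum, Finset.sum_mul]
    refine Finset.sum_congr rfl fun j _ => ?_
    rw [mul_add, add_mul, fourierOp_mul_phase_row, fourierOp_mul_phase_neg_row]
  have hcol : ∀ j, A *ᵥ Pi.single j 1 = (σ : ZMod N) • A (j + r) := by
    intro j
    rw [Matrix.mulVec_single_one]
    funext l
    rw [Matrix.col_apply, h.transpose]
    rfl
  have h2 : fourierOp A * ∑ j, (displacement (Pi.single j 1) + displacement (-Pi.single j 1)) =
      (∑ j, (phase (A j) + phase (-A j))) * fourierOp A := by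
    rw [← Equiv.sum_comp (Equiv.addRight r) fun j => phase (A j) + phase (-A j), Finset.mul_sum,
      Finset.sum_mul]
    refine Finset.sum_congr rfl fun j _ => ?_
    rw [mul_add, add_mul, fourierOp_mul_displacement, fourierOp_mul_displacement,
      Matrix.mulVec_neg, hcol, neg_neg, Equiv.coe_addRight]
    rcases hσ with rfl | rfl
    · simp [add_comm]
    · simp
  rw [hH]
  refine Commute.neg_right (Commute.smul_right ?_ _)
  rw [Commute, SemiconjBy, mul_add, add_mul, h1, h2, add_comm]

/-- The entry `⟨m| F_A F_A |s⟩` is the indicator of `Aᵀ m + A s = 0`, and `Aᵀ m + A s` is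
`A (σ T^r m + s)`; the entries of `symSum` are the indicator of the same kernel. -/
theorem fourierOp_mul_self {n : ℕ} (h : IsReflection Δ A p r σ) (hσ : σ = 1 ∨ σ = -1)
    (hΔ : IsCoupling n Δ)
    (hper : ∀ (q : Fin n) (j : ℤ), latticeFunction hΔ q (j + L) = latticeFunction hΔ q j) :
    fourierOp A * fourierOp A =
      hadamard L N ^ (1 + σ) * basisMap (rotate (-r)) * symSum hΔ := by
  ext m s
  rw [fourierOp_mul_fourierOp, h.transpose_mulVec, mul_assoc]
  rcases hσ with rfl | rfl
  · have e : chargeConj L N = basisMap (Equiv.neg (Config L N)) := rfl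
    rw [show (1 : ℤ) + 1 = (2 : ℕ) from rfl, zpow_natCast, hadamard_sq, e, basisMap_mul_apply,
      basisMap_mul_apply, symSum_apply hΔ hper, rotate_symm, neg_neg]
    refine if_congr ?_ rfl rfl
    have : rotate r (-m) = -rotate r m := by
      funext j; simp [rotate_apply]
    rw [← h.mulVec_eq_zero_iff, Equiv.neg_symm, Equiv.neg_apply, this, ← neg_add',
      Matrix.mulVec_neg, Matrix.mulVec_add, Int.cast_one, one_smul, neg_eq_zero]
  · rw [show (1 : ℤ) + -1 = 0 from rfl, zpow_zero, one_mul,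
      basisMap_mul_apply, symSum_apply hΔ hper, rotate_symm, neg_neg]
    refine if_congr ?_ rfl rfl
    rw [← h.mulVec_eq_zero_iff, Matrix.mulVec_sub, Int.cast_neg, Int.cast_one, neg_one_smul,
      ← neg_eq_zero, neg_add, neg_neg, sub_eq_add_neg]

theorem conjTranspose_fourierOp_eq (h : IsReflection Δ A p r σ) (hσ : σ = 1 ∨ σ = -1) :
    (fourierOp A)ᴴ = fourierOp A * hadamard L N ^ (1 + σ) * basisMap (rotate r) := by
  ext m s
  rw [conjTranspose_fourierOp, mul_basisMap_apply, fourierOp_apply, Matrix.neg_mulVec,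
    h.transpose_mulVec]
  rcases hσ with rfl | rfl
  · rw [show (1 : ℤ) + 1 = (2 : ℕ) from rfl, zpow_natCast, hadamard_sq, chargeConj,
      mul_basisMap_apply, fourierOp_apply, Matrix.mulVec_neg, Int.cast_one, one_smul]
  · rw [show (1 : ℤ) + -1 = 0 from rfl, zpow_zero, mul_one, fourierOp_apply, Int.cast_neg,
      Int.cast_one, neg_one_smul, neg_neg]

theorem fourierOp_mul_displacement_of_mulVec_eq_zero (h : IsReflection Δ A p r σ)
    {v : Config L N} (hv : Δ *ᵥ v = 0) : fourierOp A * displacement v = fourierOp A := by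
  rw [fourierOp_mul_displacement, (h.mulVec_eq_zero_iff v).2 hv, neg_zero, phase_zero, one_mul]

/-- The kernel of `Aᵀ = σ T^r A` contains that of `A`, because `A` commutes with translations. -/
theorem displacement_mul_fourierOp_of_mulVec_eq_zero (h : IsReflection Δ A p r σ)
    {v : Config L N} (hv : Δ *ᵥ v = 0) : displacement v * fourierOp A = fourierOp A := by
  have hrot : A *ᵥ rotate r v = rotate r (A *ᵥ v) := by
    funext j
    rw [rotate_apply, Matrix.mulVec, Matrix.mulVec, dotProduct, dotProduct,
      ← Equiv.sum_comp (Equiv.addRight r) fun l => A (j + r) l * v l]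
    refine Finset.sum_congr rfl fun l _ => ?_
    rw [rotate_apply, Equiv.coe_addRight, ← h.translation_invariant]
  have hT : Aᵀ *ᵥ v = 0 := by
    rw [h.transpose_mulVec, hrot, (h.mulVec_eq_zero_iff v).2 hv]
    funext j
    simp [rotate_apply]
  rw [← fourierOp_mul_phase, hT, phase_zero, mul_one]

end IsReflection

/-- On a reflection symmetric coupling matrix, `T^{-p} D̃_KW` is `fourierOp A` for `A = T^{-p} Δ`,
and transposing `A` costs the residual translation by `2 p - n`. -/
theorem exists_isReflection {n : ℕ} {Δ : Matrix (ZMod L) (ZMod L) (ZMod N)}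
    (hΔ : IsCoupling n Δ) {σ : ℤ}
    (hrefl : ∀ j l : ZMod L, Δᵀ j l = (σ : ZMod N) * Δ (j - n) l) (p : ℕ) :
    ∃ A, translation L N ^ (-(p : ℤ)) * kwTilde Δ = fourierOp A ∧
      IsReflection Δ A p (2 * p - n) σ := by
  refine ⟨Δ.submatrix (fun j => j + -p) id, ?_, fun j => ?_, fun j l k => ?_, fun j l => ?_⟩
  · rw [kwTilde_eq_fourierOp, translation_zpow_neg, basisMap_rotate_mul_fourierOp]
  · rw [sub_eq_add_neg]
    rfl
  · simp only [Matrix.submatrix_apply, id]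
    rw [hΔ.translation_invariant _ _ k, add_right_comm]
  · simp only [Matrix.submatrix_apply, id]
    have := hrefl j (l + -p)
    rw [Matrix.transpose_apply] at this
    rw [this, hΔ.translation_invariant (j - n) _ p, neg_add_cancel_right]
    congr 2
    ring

end

end KWIsing

open KWIsing in
theorem mainTheorem7 (L N n : ℕ) [NeZero L] [NeZero N]
    (Δ : Matrix (ZMod L) (ZMod L) (ZMod N)) (hΔ : IsCoupling n Δ)
    (hper : ∀ (q : Fin n) (j : ℤ), latticeFunction hΔ q (j + L) = latticeFunction hΔ q j)
    (σ : ℤ) (hσ : σ = 1 ∨ σ = -1)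
    (hrefl : ∀ j l : ZMod L, Δᵀ j l = (σ : ZMod N) * Δ (j - n) l) :
    -- the operator implementing the Kramers-Wannier transformation, unique up to a scalar
    (ImplementsKW Δ (kwTilde Δ) ∧
      ∀ A : Op L N, ImplementsKW Δ A → ∃ c : ℂ, A = c • kwTilde Δ) ∧
    -- symmetry of the Hamiltonian at `J = h`
    (∀ J h : ℝ, J = h → Commute (kw n Δ) (hamiltonian Δ J h)) ∧
    -- the operator algebra
    kw n Δ * kw n Δ =
      hadamard L N ^ (1 + σ) * (translation L N)ᴴ ^ (n % 2) * symSum hΔ ∧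
    (∀ q : Fin n, symOp hΔ q * kw n Δ = kw n Δ ∧ kw n Δ * symOp hΔ q = kw n Δ) ∧
    (kw n Δ)ᴴ = kw n Δ * hadamard L N ^ (1 + σ) * translation L N ^ (n % 2) ∧
    -- translation only for odd `n`, charge conjugation when `σ = +1`
    (Even n → kw n Δ * kw n Δ = hadamard L N ^ (1 + σ) * symSum hΔ) ∧
    (Odd n → kw n Δ * kw n Δ = hadamard L N ^ (1 + σ) * (translation L N)ᴴ * symSum hΔ) ∧
    (σ = 1 → hadamard L N ^ (1 + σ) = chargeConj L N) ∧
    (σ = -1 → hadamard L N ^ (1 + σ) = 1) ∧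
    (∀ j : ZMod L,
      (chargeConj L N : Op L N) * shift j = (shift j)ᴴ * chargeConj L N ∧
      (chargeConj L N : Op L N) * clock j = (clock j)ᴴ * chargeConj L N) ∧
    -- the same algebra with the opposite direction of translation, for `T^{-⌊n/2⌋} D̃_KW`
    (∀ D : Op L N, D = translation L N ^ (-((n / 2 : ℕ) : ℤ)) * kwTilde Δ →
      (∀ J h : ℝ, J = h → Commute D (hamiltonian Δ J h)) ∧
      D * D = hadamard L N ^ (1 + σ) * translation L N ^ (n % 2) * symSum hΔ ∧
      (∀ q : Fin n, symOp hΔ q * D = D ∧ D * symOp hΔ q = D) ∧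
      Dᴴ = D * hadamard L N ^ (1 + σ) * (translation L N)ᴴ ^ (n % 2)) := by
  have hmod : ((n / 2 : ℕ) : ZMod L) * 2 + ((n % 2 : ℕ) : ZMod L) = n := by
    exact_mod_cast congrArg (Nat.cast : ℕ → ZMod L) (show n / 2 * 2 + n % 2 = n by omega)
  have hmod' : (((n + 1) / 2 : ℕ) : ZMod L) * 2 = n + ((n % 2 : ℕ) : ZMod L) := by
    exact_mod_cast congrArg (Nat.cast : ℕ → ZMod L)
      (show (n + 1) / 2 * 2 = n + n % 2 by omega)
  obtain ⟨A, hA, h⟩ := exists_isReflection hΔ hrefl ((n + 1) / 2)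
  rw [show (2 * (((n + 1) / 2 : ℕ) : ZMod L) - n) = ((n % 2 : ℕ) : ZMod L) by
    rw [mul_comm, hmod', add_sub_cancel_left]] at h
  obtain ⟨B, hB, h'⟩ := exists_isReflection hΔ hrefl (n / 2)
  rw [show (2 * ((n / 2 : ℕ) : ZMod L) - n) = -((n % 2 : ℕ) : ZMod L) by
    rw [← hmod]; ring] at h'
  have hsq : kw n Δ * kw n Δ =
      hadamard L N ^ (1 + σ) * (translation L N)ᴴ ^ (n % 2) * symSum hΔ := by
    rw [kw, hA, h.fourierOp_mul_self hσ hΔ hper, conjTranspose_translation_pow]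
  have hker := mulVec_ringFunction hΔ hper
  refine ⟨?_, ?_, hsq, ?_, ?_, ?_, ?_, ?_, ?_, ?_, ?_⟩
  · rw [kwTilde_eq_fourierOp]
    exact ⟨implementsKW_fourierOp Δ, fun A hA => hA.exists_eq_smul⟩
  · rintro J _ rfl
    rw [kw, hA]
    exact h.commute_hamiltonian hσ J
  · intro q
    rw [kw, hA, symOp_eq_displacement]
    exact ⟨h.displacement_mul_fourierOp_of_mulVec_eq_zero (hker q),
      h.fourierOp_mul_displacement_of_mulVec_eq_zero (hker q)⟩
  · rw [kw, hA, translation_pow]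
    exact h.conjTranspose_fourierOp_eq hσ
  · intro hn
    rw [hsq, Nat.even_iff.1 hn, pow_zero, mul_one]
  · intro hn
    rw [hsq, Nat.odd_iff.1 hn, pow_one]
  · rintro rfl
    exact hadamard_sq
  · rintro rfl
    exact zpow_zero _
  · exact fun j => ⟨chargeConj_mul_shift j, chargeConj_mul_clock j⟩
  · rintro D rfl
    rw [hB]
    refine ⟨?_, ?_, fun q => ?_, ?_⟩
    · rintro J _ rfl
      exact h'.commute_hamiltonian hσ J
    · rw [h'.fourierOp_mul_self hσ hΔ hper, translation_pow, neg_neg]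
    · rw [symOp_eq_displacement]
      exact ⟨h'.displacement_mul_fourierOp_of_mulVec_eq_zero (hker q),
        h'.fourierOp_mul_displacement_of_mulVec_eq_zero (hker q)⟩
    · rw [conjTranspose_translation_pow]
      exact h'.conjTranspose_fourierOp_eq hσ
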